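/- **Conventions.** Algebras are of a fixed finitary signature; $\mathrm{Con}(A)$ is the lattice of congruences of an algebra $A$, with least element $0_A$ (equality). For $\alpha,\beta\in\mathrm{Con}(A)$, let $M(\alpha,\beta)$ be the subalgebra of $A^4$ (viewed as the algebra of $2\times 2$ matrices over $A$) generated by all matrices $$\begin{pmatrix}a&a\\a'&a'\end{pmatrix}\ (a\,\alpha\,a')\qquad\text{and}\qquad\begin{pmatrix}b&b'\\b&b'\end{pmatrix}\ (b\,\beta\,b').$$ For $\delta\in\mathrm{Con}(A)$, write $C(\alpha,\beta;\delta)$ if for every $\begin{pmatrix}p&q\\r&s\end{pmatrix}\in M(\alpha,\beta)$, $p\,\delta\,q$ implies $r\,\delta\,s$. The commutator is $[\alpha,\beta]:=\bigwedge\{\delta\in\mathrm{Con}(A): C(\alpha,\beta;\delta)\}$. A variety $\mathcal V$ (the class of all algebras satisfying a given set of identities) is congruence modular if $\mathrm{Con}(B)$ is a modular lattice for every $B\in\mathcal V$. A ternary term $d(x,y,z)$ is a *Gumm difference term* for $\mathcal V$ if (1) $\mathcal V$ satisfies $d(x,x,y)\approx y$, and (2) for all $B\in\mathcal V$, $\theta\in\mathrm{Con}(B)$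 and $x,y\in B$, $x\,\theta\,y$ implies $d(x,y,y)\,[\theta,\theta]\,x$. **Theorem.** Let $A$ be an algebra in a congruence modular variety $\mathcal V$ with Gumm difference term $d(x,y,z)$, and let $\alpha,\beta\in\mathrm{Con}(A)$ with $\beta\le\alpha$. The following are equivalent: (a) $[\alpha,\beta]=0_A$. (b) Both of the following hold: (i) for every $n$, every $n$-ary term $t$, and all $x_i,y_i,z_i\in A$ with $x_i\,\beta\,y_i\,\alpha\,z_i$ for $1\le i\le n$, $$t\big(d(x_1,y_1,z_1),\dots,d(x_n,y_n,z_n)\big)=d\big(t(x_1,\dots,x_n),\,t(y_1,\dots,y_n),\,t(z_1,\dots,z_n)\big);$$ (ii) for all $y,z\in A$, $y\,\beta\,z$ implies $d(y,z,z)=y=d(z,z,y)$. -/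

import Mathlib

universe u v w

namespace UniversalAlgebra

/-- A congruence relation on the algebra `A`: an equivalence relation that is compatible with
all fundamental operations. -/
@[ext]
structure Congruence (L : FirstOrder.Language.{u, v}) (A : Type w) [L.Structure A] extends Setoid A where
  compatible : ∀ {n : ℕ} (f : L.Functions n) (x y : Fin n → A), (∀ i, r (x i) (y i)) →
    r (FirstOrder.Language.Structure.funMap f x) (FirstOrder.Language.Structure.funMap f y)

namespace Congruence

variable {L : FirstOrder.Language.{u, v}} {A : Type w} [L.Structure A]

instance : CoeFun (Congruence L A) (fun _ => A → A → Prop) := ⟨fun α => α.r⟩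

/-- Congruences are ordered by inclusion. -/
instance : PartialOrder (Congruence L A) where
  le α β := ∀ ⦃x y : A⦄, α x y → β x y
  le_refl _ _ _ h := h
  le_trans _ _ _ h₁ h₂ _ _ h := h₂ (h₁ h)
  le_antisymm α β h₁ h₂ := by
    apply Congruence.ext
    funext x y
    exact propext ⟨fun h => h₁ h, fun h => h₂ h⟩

/-- The intersection of a set of congruences. -/
instance : InfSet (Congruence L A) where
  sInf S :=
    { r := fun x y => ∀ α ∈ S, α x y
      iseqv := ⟨fun x α _ => α.iseqv.refl x, fun h α hα => α.iseqv.symm (h α hα),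
        fun h₁ h₂ α hα => α.iseqv.trans (h₁ α hα) (h₂ α hα)⟩
      compatible := fun f x y h α hα => α.compatible f x y fun i => h i α hα }

/-- The lattice of all congruences of `A`: meets are intersections, `⊥` is the equality relation,
`⊤` is the full relation, and joins are least upper bounds. -/
instance : CompleteLattice (Congruence L A) where
  __ := completeLatticeOfInf (Congruence L A) fun _ =>
    ⟨fun _ hα _ _ h => h _ hα, fun _ hγ _ _ h _ hα => hγ hα h⟩
  inf α β :=
    { r := fun x y => α x y ∧ β x y
      iseqv := ⟨fun x => ⟨α.iseqv.refl x, β.iseqv.refl x⟩,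
        fun h => ⟨α.iseqv.symm h.1, β.iseqv.symm h.2⟩,
        fun h₁ h₂ => ⟨α.iseqv.trans h₁.1 h₂.1, β.iseqv.trans h₁.2 h₂.2⟩⟩
      compatible := fun f x y h =>
        ⟨α.compatible f x y fun i => (h i).1, β.compatible f x y fun i => (h i).2⟩ }
  inf_le_left _ _ _ _ h := h.1
  inf_le_right _ _ _ _ h := h.2
  le_inf _ _ _ h₁ h₂ _ _ h := ⟨h₁ h, h₂ h⟩
  bot :=
    { r := fun x y => x = y
      iseqv := ⟨fun _ => rfl, fun h => h.symm, fun h₁ h₂ => h₁.trans h₂⟩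
      compatible := fun f x y h => congrArg (FirstOrder.Language.Structure.funMap f) (funext h) }
  bot_le α x y h := by
    cases h
    exact α.iseqv.refl x
  top :=
    { r := fun _ _ => True
      iseqv := ⟨fun _ => trivial, fun _ => trivial, fun _ _ => trivial⟩
      compatible := fun _ _ _ _ => trivial }
  le_top _ _ _ _ := trivial

end Congruence

/-- The direct product of a family of algebras, with operations computed coordinatewise. -/
instance piStructure (L : FirstOrder.Language.{u, v}) {ι : Type*} (A : ι → Type*) [∀ i, L.Structure (A i)] :
    L.Structure (∀ i, A i) where
  funMap f x := fun i => FirstOrder.Language.Structure.funMap f fun j => x j i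
  RelMap R x := ∀ i, FirstOrder.Language.Structure.RelMap R fun j => x j i

section Commutator

variable {L : FirstOrder.Language.{u, v}} {A : Type w} [L.Structure A]

/-- `M(α, β)`: the subalgebra of the algebra `A⁴` of `2 × 2` matrices generated by the matrices
with rows `(a, a), (a', a')` for `a α a'` and those with rows `(b, b'), (b, b')` for `b β b'`. -/
def matrixAlgebra (α β : Congruence L A) : L.Substructure (Fin 2 → Fin 2 → A) :=
  FirstOrder.Language.Substructure.closure L
    ({m | ∃ a a' : A, α a a' ∧ m = ![![a, a], ![a', a']]} ∪
      {m | ∃ b b' : A, β b b' ∧ m = ![![b, b'], ![b, b']]})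

/-- `C(α, β; δ)`: `α` centralizes `β` modulo `δ`, i.e. whenever the entries of the first row of a
matrix in `M(α, β)` are `δ`-related, so are those of the second row. -/
def Centralizes (α β δ : Congruence L A) : Prop :=
  ∀ m ∈ matrixAlgebra α β, δ (m 0 0) (m 0 1) → δ (m 1 0) (m 1 1)

/-- The (term condition) commutator `[α, β]`: the meet of all congruences modulo which `α`
centralizes `β`. -/
def commutator (α β : Congruence L A) : Congruence L A :=
  sInf {δ | Centralizes α β δ}

end Commutator

/-- A variety of algebras of signature `L`, presented by a set of identities `s ≈ t`. -/
structure Variety (L : FirstOrder.Language.{u, v}) where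
  identities : Set (L.Term ℕ × L.Term ℕ)

namespace Variety

variable {L : FirstOrder.Language.{u, v}}

/-- `A ∈ V`: the algebra `A` satisfies all identities of the variety `V`. -/
def Contains (V : Variety L) (A : Type w) [L.Structure A] : Prop :=
  ∀ p ∈ V.identities, ∀ x : ℕ → A, p.1.realize x = p.2.realize x

/-- The congruence lattice of every algebra (in the universe `w`) of the variety is modular. -/
def CongruenceModular (V : Variety L) : Prop :=
  ∀ (A : Type w) [L.Structure A], V.Contains A → IsModularLattice (Congruence L A)

/-- `d(x, y, z)` is a Gumm difference term for the variety `V`: `V` satisfies `d(x, x, y) ≈ y`, and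
`x α y` implies `d(x, y, y) [α, α] x` for every congruence `α` of every `A ∈ V`. -/
def IsGummDifferenceTerm (V : Variety L) (d : L.Term (Fin 3)) : Prop :=
  (∀ (A : Type w) [L.Structure A], V.Contains A → ∀ x y : A, d.realize ![x, x, y] = y) ∧
  (∀ (A : Type w) [L.Structure A], V.Contains A → ∀ (α : Congruence L A) (x y : A),
    α x y → commutator α α (d.realize ![x, y, y]) x)

end Variety

/-- The operations `f` (`n`-ary) and `g` (`m`-ary) commute on the `m × n` matrix `x`: applying `f`
to each row and `g` to the resulting column gives the same as applying `g` to each column and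
`f` to the resulting row. -/
def CommuteOn {A : Type w} {n m : ℕ} (f : (Fin n → A) → A) (g : (Fin m → A) → A)
    (x : Fin m → Fin n → A) : Prop :=
  g (fun i => f (x i)) = f (fun j => g fun i => x i j)

end UniversalAlgebra

namespace UniversalAlgebra

open FirstOrder.Language

section

variable {L : FirstOrder.Language.{u, v}}

/-! When `[α, β] = ⊥`, a matrix with rows `(p, q)`, `(r, s)` in `M(α, β)` behaves like a
parallelogram whose fourth corner is `s = d(q, p, r)`. If `d` commutes with terms on `β`-`α`-chains,
the matrices of this form are closed under the operations and include the generators; `p = q` then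
forces `s = d(p, p, r) = r`, which is centrality modulo equality (`commutator_eq_bot_of_commuteOn`).
Conversely, centrality makes the fourth corner unique (`eq_of_mem_matrixAlgebra`). Both sides of the
commutation identity are fourth corners over the same three entries, so they agree. -/

theorem realize_pi {ι : Type*} {A : ι → Type*} [∀ i, L.Structure (A i)] {κ : Type*}
    (t : L.Term κ) (x : κ → ∀ i, A i) (i : ι) :
    t.realize x i = t.realize fun k => x k i := by
  induction t with
  | var k => rfl
  | func f ts ih =>
    simp only [Term.realize_func]
    exact congrArg (Structure.funMap f) (funext ih)

variable {A : Type w} [L.Structure A]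

theorem Congruence.realize (θ : Congruence L A) {κ : Type*} (t : L.Term κ) {x y : κ → A}
    (h : ∀ k, θ (x k) (y k)) : θ (t.realize x) (t.realize y) := by
  induction t with
  | var k => exact h k
  | func f ts ih => exact θ.compatible f _ _ ih

theorem col_mem_matrixAlgebra {α β : Congruence L A} {a a' : A} (h : α a a') :
    ![![a, a], ![a', a']] ∈ matrixAlgebra α β :=
  Substructure.subset_closure (Or.inl ⟨a, a', h, rfl⟩)

theorem row_mem_matrixAlgebra {α β : Congruence L A} {b b' : A} (h : β b b') :
    ![![b, b'], ![b, b']] ∈ matrixAlgebra α β :=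
  Substructure.subset_closure (Or.inr ⟨b, b', h, rfl⟩)

theorem realize_mem_matrixAlgebra {α β : Congruence L A} {κ : Type*} (t : L.Term κ)
    {p q r s : κ → A} (h : ∀ k, ![![p k, q k], ![r k, s k]] ∈ matrixAlgebra α β) :
    ![![t.realize p, t.realize q], ![t.realize r, t.realize s]] ∈ matrixAlgebra α β := by
  have hm := t.realize_mem (fun k => ![![p k, q k], ![r k, s k]]) h
  convert hm using 1
  funext i j
  rw [realize_pi, realize_pi]
  fin_cases i <;> fin_cases j <;> rfl

theorem matrixAlgebra_mono {α α' β β' : Congruence L A} (hα : α ≤ α') (hβ : β ≤ β') :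
    matrixAlgebra α β ≤ matrixAlgebra α' β' := by
  refine (Substructure.closure L).monotone (Set.union_subset_union ?_ ?_)
  · rintro m ⟨a, a', h, rfl⟩
    exact ⟨a, a', hα h, rfl⟩
  · rintro m ⟨b, b', h, rfl⟩
    exact ⟨b, b', hβ h, rfl⟩

theorem commutator_mono {α α' β β' : Congruence L A} (hα : α ≤ α') (hβ : β ≤ β') :
    commutator α β ≤ commutator α' β' :=
  fun _ _ hxy δ hδ => hxy δ fun m hm => hδ m (matrixAlgebra_mono hα hβ hm)

theorem centralizes_commutator (α β : Congruence L A) : Centralizes α β (commutator α β) :=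
  fun m hm h δ hδ => hδ m hm (h δ hδ)

/-- If `d` commutes with all terms on `β`-`α`-chains, then every matrix `(p, q), (r, s)` in
`M(α, β)` satisfies `s = d(q, p, r)`, and hence `[α, β]` is equality. -/
theorem commutator_eq_bot_of_commuteOn {α β : Congruence L A} (d : L.Term (Fin 3))
    (hd : ∀ x y : A, d.realize ![x, x, y] = y)
    (hcomm : ∀ (n : ℕ) (t : L.Term (Fin n)) (x y z : Fin n → A),
      (∀ i, β (x i) (y i) ∧ α (y i) (z i)) →
        CommuteOn (fun r : Fin 3 → A => d.realize r)
          (fun c : Fin n → A => t.realize c) (fun i => ![x i, y i, z i]))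
    (hdβ : ∀ y z : A, β y z → d.realize ![y, z, z] = y) :
    commutator α β = ⊥ := by
  let S : L.Substructure (Fin 2 → Fin 2 → A) :=
    { carrier := {m | β (m 0 1) (m 0 0) ∧ α (m 0 0) (m 1 0) ∧
        m 1 1 = d.realize ![m 0 1, m 0 0, m 1 0]}
      fun_mem := by
        intro n f m hm
        refine ⟨β.compatible f _ _ fun i => (hm i).1, α.compatible f _ _ fun i => (hm i).2.1, ?_⟩
        -- Closure under `f` is exactly commutation of `d` with the term `f(v₁, …, vₙ)`.
        have h := hcomm n (.func f Term.var) (fun i => m i 0 1) (fun i => m i 0 0)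
          (fun i => m i 1 0) fun i => ⟨(hm i).1, (hm i).2.1⟩
        have h₁ : Structure.funMap f (fun i => m i 1 1) =
            Structure.funMap f (fun i => d.realize ![m i 0 1, m i 0 0, m i 1 0]) :=
          congrArg _ (funext fun i => (hm i).2.2)
        refine h₁.trans (h.trans (congrArg (fun r : Fin 3 → A => d.realize r) (funext fun j => ?_)))
        fin_cases j <;> rfl }
  have hS : matrixAlgebra α β ≤ S := by
    refine (Substructure.closure_le (L := L)).2 (Set.union_subset ?_ ?_)
    · rintro m ⟨a, a', h, rfl⟩
      exact ⟨β.iseqv.refl a, h, (hd a a').symm⟩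
    · rintro m ⟨b, b', h, rfl⟩
      exact ⟨β.iseqv.symm h, α.iseqv.refl b, (hdβ b' b (β.iseqv.symm h)).symm⟩
  have hC : Centralizes α β ⊥ := by
    intro m hm hrow
    have hrow' : m 0 0 = m 0 1 := hrow
    have h := (hS hm).2.2
    rw [hrow', hd] at h
    exact h.symm
  exact le_bot_iff.1 fun x y hxy => hxy ⊥ hC

/-- If `α` centralizes `β` modulo equality, a matrix in `M(α, β)` is determined by its first row
and first column. -/
theorem eq_of_mem_matrixAlgebra {α β : Congruence L A} (hC : Centralizes α β ⊥)
    (d : L.Term (Fin 3)) (hd : ∀ x y : A, d.realize ![x, x, y] = y)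
    (hdβ : ∀ y z : A, β y z → d.realize ![y, z, z] = y) {p q r s s' : A}
    (hs : ![![p, q], ![r, s]] ∈ matrixAlgebra α β)
    (hs' : ![![p, q], ![r, s']] ∈ matrixAlgebra α β) (hqs : α q s) (hss' : β s' s) : s = s' := by
  -- The third argument, with rows `(q, q)`, `(s, s)`, makes both first-row entries collapse to `q`,
  -- while the second row becomes `(s, s')`.
  have hm : ![![d.realize ![p, p, q], d.realize ![q, q, q]],
      ![d.realize ![r, r, s], d.realize ![s', s, s]]] ∈ matrixAlgebra α β := by
    refine realize_mem_matrixAlgebra d fun k => ?_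
    fin_cases k
    · exact hs'
    · exact hs
    · exact col_mem_matrixAlgebra hqs
  have h : d.realize ![r, r, s] = d.realize ![s', s, s] :=
    hC _ hm ((hd p q).trans (hd q q).symm)
  rwa [hd, hdβ s' s hss'] at h

/-- Applying `t` before or after completing by `d` gives two matrices with first row `(t(y), t(x))`
and lower left entry `t(z)`; uniqueness identifies their last entries. -/
theorem commuteOn_of_centralizes_bot {α β : Congruence L A} (hC : Centralizes α β ⊥)
    (d : L.Term (Fin 3)) (hd : ∀ x y : A, d.realize ![x, x, y] = y)
    (hdβ : ∀ y z : A, β y z → d.realize ![y, z, z] = y) {n : ℕ} (t : L.Term (Fin n))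
    (x y z : Fin n → A) (h : ∀ i, β (x i) (y i) ∧ α (y i) (z i)) :
    CommuteOn (fun r : Fin 3 → A => d.realize r)
      (fun c : Fin n → A => t.realize c) (fun i => ![x i, y i, z i]) := by
  have hxy : β (t.realize x) (t.realize y) := β.realize t fun i => (h i).1
  have hyz : α (t.realize y) (t.realize z) := α.realize t fun i => (h i).2
  have hdm {a b c : A} (hab : β a b) (hbc : α b c) :
      ![![b, a], ![c, d.realize ![a, b, c]]] ∈ matrixAlgebra α β := by
    -- `d` applied to three generators, with the constant matrix `b` in the middle; `d(a, b, b) = a`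
    -- needs `a β b`.
    have hm : ![![d.realize ![b, b, b], d.realize ![a, b, b]],
        ![d.realize ![b, b, c], d.realize ![a, b, c]]] ∈ matrixAlgebra α β := by
      refine realize_mem_matrixAlgebra d fun k => ?_
      fin_cases k
      · exact row_mem_matrixAlgebra (β.iseqv.symm hab)
      · exact col_mem_matrixAlgebra (α.iseqv.refl b)
      · exact col_mem_matrixAlgebra hbc
    rwa [hd, hd, hdβ a b hab] at hm
  have hdβ' {a b c : A} (hab : β a b) : β (d.realize ![a, b, c]) c := by
    have := β.realize d (x := ![a, b, c]) (y := ![b, b, c]) fun k => by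
      fin_cases k
      · exact hab
      · exact β.iseqv.refl b
      · exact β.iseqv.refl c
    rwa [hd] at this
  have hdα {a b c : A} (hab : β a b) (hbc : α b c) : α a (d.realize ![a, b, c]) := by
    have := α.realize d (x := ![a, b, b]) (y := ![a, b, c]) fun k => by
      fin_cases k
      · exact α.iseqv.refl a
      · exact α.iseqv.refl b
      · exact hbc
    rwa [hdβ a b hab] at this
  have key : t.realize (fun i => d.realize ![x i, y i, z i]) =
      d.realize ![t.realize x, t.realize y, t.realize z] :=
    eq_of_mem_matrixAlgebra hC d hd hdβ
      (realize_mem_matrixAlgebra t fun i => hdm (h i).1 (h i).2) (hdm hxy hyz)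
      (α.realize t fun i => hdα (h i).1 (h i).2)
      -- Both candidates are `β`-related to `t(z)`.
      (β.iseqv.trans (hdβ' hxy)
        (β.iseqv.symm (β.realize t fun i => hdβ' (h i).1)))
  refine key.trans (congrArg (fun r : Fin 3 → A => d.realize r) (funext fun j => ?_))
  fin_cases j <;> rfl

end

end UniversalAlgebra

theorem mainTheorem10 {L : FirstOrder.Language.{u, v}} [L.IsAlgebraic]
    (V : UniversalAlgebra.Variety L) (hV : UniversalAlgebra.Variety.CongruenceModular.{u, v, w} V)
    (d : L.Term (Fin 3)) (hd : UniversalAlgebra.Variety.IsGummDifferenceTerm.{u, v, w} V d)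
    (A : Type w) [L.Structure A] (hA : V.Contains A)
    (α β : UniversalAlgebra.Congruence L A) (hβα : β ≤ α) :
    UniversalAlgebra.commutator α β = ⊥ ↔
      (∀ (n : ℕ) (t : L.Term (Fin n)) (x y z : Fin n → A),
        (∀ i, β (x i) (y i) ∧ α (y i) (z i)) →
          UniversalAlgebra.CommuteOn (fun r : Fin 3 → A => d.realize r)
            (fun c : Fin n → A => t.realize c) (fun i => ![x i, y i, z i])) ∧
      (∀ y z : A, β y z → d.realize ![y, z, z] = y ∧ y = d.realize ![z, z, y]) := by
  have hd₁ : ∀ x y : A, d.realize ![x, x, y] = y := hd.1 A hA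
  constructor
  · intro h
    have hC : UniversalAlgebra.Centralizes α β ⊥ :=
      h ▸ UniversalAlgebra.centralizes_commutator α β
    have hdβ : ∀ y z : A, β y z → d.realize ![y, z, z] = y := fun y z hyz => by
      -- The difference term gives equality modulo `[β, β]`, which lies below `[α, β] = ⊥` because
      -- `β ≤ α`.
      have hyz' := UniversalAlgebra.commutator_mono hβα le_rfl (hd.2 A hA β y z hyz)
      rw [h] at hyz'
      exact hyz'
    exact ⟨fun n t x y z hxyz =>
        UniversalAlgebra.commuteOn_of_centralizes_bot hC d hd₁ hdβ t x y z hxyz,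
      fun y z hyz => ⟨hdβ y z hyz, (hd₁ z y).symm⟩⟩
  · rintro ⟨hcomm, hdβ⟩
    exact UniversalAlgebra.commutator_eq_bot_of_commuteOn d hd₁ hcomm fun y z hyz =>
      (hdβ y z hyz).1
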